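/- \textbf{Theorem.} A flow $(X,(\phi_t)_{t\in\mathbb R})$ on a nonempty compact metrizable space $X$ is a continuous map $(t,x)\mapsto\phi_t(x)$ from $\mathbb R\times X$ to $X$ with $\phi_0=\mathrm{id}$ and $\phi_{t+s}=\phi_t\circ\phi_s$; a point $x$ is fixed if $\phi_t(x)=x$ for all $t\in\mathbb R$. For a distance $d$ giving the topology of $X$ put $d^\phi_{[0,r]}(x,x')=\max_{0\le t\le r}d(\phi_t(x),\phi_t(x'))$ and $$\mathrm{mdim}(X,(\phi_t))=\lim_{\epsilon\to0}\lim_{r\to+\infty}\frac{\mathrm{Widim}_\epsilon(X,d^\phi_{[0,r]})}{r}\in[0,+\infty],$$ where $\mathrm{Widim}_\epsilon(X,d)$ is the minimum Lebesgue covering dimension of a compact metrizable space $P$ admitting a continuous map $f:X\to P$ such that $f(x)=f(x')$ implies $d(x,x')\le\epsilon$ (this is independent of the choice of $d$). Let $(X,(\phi_t)_{t\in\mathbb R})$ and $(Y,(\psi_s)_{s\in\mathbb R})$ be flows without fixed points on nonempty compact metrizable spaces. Suppose that they are weakly equivalent via a homeomorphism $\pi:X\to Y$, i.e. $\pi$ maps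 orbits of $(\phi_t)$ onto orbits of $(\psi_s)$ and preserves the time-orientation of each orbit: for every $x\in X$ there is an increasing bijection $h:\mathbb R\to\mathbb R$ with $\pi(\phi_t(x))=\psi_{h(t)}(\pi(x))$ for all $t\in\mathbb R$. Then there is a unique continuous map $\theta:\mathbb R\times X\to\mathbb R$ such that, for all $t,t'\in\mathbb R$ and $x\in X$, $\psi_{\theta(t,x)}(\pi(x))=\pi(\phi_t(x))$, $\theta(0,x)=0$, $\theta(\cdot,x)$ is strictly increasing, and $\theta(t'+t,x)=\theta(t',\phi_t(x))+\theta(t,x)$. The numbers $m=\min_{x\in X}\theta(1,x)$ and $M=\max_{x\in X}\theta(1,x)$ exist and satisfy $0<m\le M<+\infty$, and $$m\cdot\mathrm{mdim}(Y,(\psi_s)_{s\in\mathbb R})\le\mathrm{mdim}(X,(\phi_t)_{t\in\mathbb R})\le M\cdot\mathrm{mdim}(Y,(\psi_s)_{s\in\mathbb R}).$$ In particular, $\mathrm{mdim}(X,(\phi_t)_{t\in\mathbb R})=C\cdot\mathrm{mdim}(Y,(\psi_s)_{s\in\mathbb R})$ for some finite number $C>0$ (which may depend on the two flows). -/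

import Mathlib

open Set Filter Topology
open scoped ENNReal

/-- The Lebesgue covering dimension of `P` is at most `n`: every open cover has an open refinement
such that no point lies in more than `n + 1` of its members. -/
def CoveringDimLE (P : Type*) [TopologicalSpace P] (n : ℕ) : Prop :=
  ∀ U : Set (Set P), (∀ u ∈ U, IsOpen u) → ⋃₀ U = univ →
    ∃ V : Set (Set P), (∀ v ∈ V, IsOpen v) ∧ ⋃₀ V = univ ∧ (∀ v ∈ V, ∃ u ∈ U, v ⊆ u) ∧
      ∀ x : P, {v ∈ V | x ∈ v}.encard ≤ n + 1

/-- The Lebesgue covering dimension of a (nonempty) space, `⊤` if it is infinite. -/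
noncomputable def coveringDim (P : Type*) [TopologicalSpace P] : ℕ∞ :=
  ⨅ (n : ℕ) (_ : CoveringDimLE P n), (n : ℕ∞)

/-- The `ε`-width dimension of `X` with respect to a distance `d`: the least covering dimension of
a compact metrizable space `P` that receives a continuous map `f : X → P` with
`f x = f x' → d x x' ≤ ε`. Every compact metrizable space is homeomorphic to a subspace of the
Hilbert cube, so it is enough to let `P` range over `Type`. -/
noncomputable def widim {X : Type*} [TopologicalSpace X] (d : X → X → ℝ) (ε : ℝ) : ℕ∞ :=
  sInf {k : ℕ∞ | ∃ (P : Type) (_ : TopologicalSpace P) (_ : CompactSpace P)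
    (_ : TopologicalSpace.MetrizableSpace P) (f : X → P),
      Continuous f ∧ (∀ x x', f x = f x' → d x x' ≤ ε) ∧ coveringDim P = k}

/-- The Bowen distance `max_{0 ≤ t ≤ r} d (φ_t x, φ_t x')` over the time interval `[0, r]`. -/
noncomputable def bowenDist {X : Type*} [MetricSpace X] (φ : Flow ℝ X) (r : ℝ) (x x' : X) : ℝ :=
  ⨆ t : Icc (0 : ℝ) r, dist (φ t x) (φ t x')

/-- The mean dimension `lim_{ε → 0} lim_{r → ∞} Widim_ε (X, d_{[0, r]}) / r` of a flow, in `[0, ∞]`.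
The numerator is subadditive in `r`, so the inner limit exists and is the upper limit; it increases
as `ε` decreases, so the outer limit is the supremum over `ε > 0`. -/
noncomputable def meanDim {X : Type*} [MetricSpace X] (φ : Flow ℝ X) : ℝ≥0∞ :=
  ⨆ (ε : ℝ) (_ : 0 < ε),
    limsup (fun r : ℝ => ((widim (bowenDist φ r) ε : ℕ∞) : ℝ≥0∞) / ENNReal.ofReal r) atTop

/-- No point is fixed by all times of the flow. -/
def NoFixedPoint {X : Type*} [TopologicalSpace X] (φ : Flow ℝ X) : Prop :=
  ∀ x, ∃ t : ℝ, φ t x ≠ x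

/-- The homeomorphism `π` is a weak equivalence: it maps each orbit of `φ` onto an orbit of `ψ` and
preserves the time-orientation, that is, up to an increasing bijective change of time on each
orbit it carries the motion under `φ` to the motion under `ψ`. -/
def IsWeakEquivalence {X Y : Type*} [TopologicalSpace X] [TopologicalSpace Y]
    (φ : Flow ℝ X) (ψ : Flow ℝ Y) (π : X ≃ₜ Y) : Prop :=
  ∀ x, ∃ h : ℝ ≃o ℝ, ∀ t : ℝ, π (φ t x) = ψ (h t) (π x)

/-- A weak equivalence maps orbits onto orbits. -/
theorem IsWeakEquivalence.image_orbit {X Y : Type*} [TopologicalSpace X] [TopologicalSpace Y]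
    {φ : Flow ℝ X} {ψ : Flow ℝ Y} {π : X ≃ₜ Y} (hπ : IsWeakEquivalence φ ψ π) (x : X) :
    π '' φ.orbit x = ψ.orbit (π x) := by
  obtain ⟨h, hh⟩ := hπ x
  rw [Flow.orbit_eq_range, Flow.orbit_eq_range, ← range_comp]
  ext y
  constructor
  · rintro ⟨t, rfl⟩
    exact ⟨h t, (hh t).symm⟩
  · rintro ⟨s, rfl⟩
    exact ⟨h.symm s, by simp [hh]⟩

/-- `θ` is the time-reparameterization induced by `π`:
`ψ_{θ (t, x)} (π x) = π (φ_t x)`, with `θ` vanishing at time `0`, strictly increasing in time,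
a cocycle over `φ`, and jointly continuous. -/
structure IsTimeChange {X Y : Type*} [TopologicalSpace X] [TopologicalSpace Y]
    (φ : Flow ℝ X) (ψ : Flow ℝ Y) (π : X ≃ₜ Y) (θ : ℝ → X → ℝ) : Prop where
  conj : ∀ t x, ψ (θ t x) (π x) = π (φ t x)
  zero : ∀ x, θ 0 x = 0
  strictMono : ∀ x, StrictMono fun t => θ t x
  cocycle : ∀ t' t x, θ (t' + t) x = θ t' (φ t x) + θ t x
  continuous : Continuous fun p : ℝ × X => θ p.1 p.2

/-!
Along an orbit without fixed points the time change is determined by `π`: two candidates differ by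
a continuous function with values in the periods of a point, and the periods of a flow without
fixed points on a compact space are bounded away from `0` (`NoFixedPoint.exists_period_bound`,
`NoFixedPoint.lift_unique`). Uniqueness yields the cocycle identity. Joint continuity
(`IsWeakEquivalence.exists_isTimeChange`) is first obtained for short times, for which the time
change stays below half a lower bound of the periods and can be read off from the end points, and
then follows for all times from the cocycle identity.

The comparison of mean dimensions has to deal with the drift of `θ t x - θ t x'` for large
`t`, even if `x` and `x'` have `ψ`-close images for a long time. The drift is cut off by recording
the elapsed times `θ (k L) x`, `k ≤ r / L`, in addition to a map that controls the Bowen distance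
of `ψ`: points with the same data have close images at each of the times `k L`, and by uniform
continuity of `φ` on bounded time intervals they stay close in between
(`IsTimeChange.widim_bowenDist_le`). This takes about `r / L` additional real parameters, and each
of them raises the covering dimension of the target by at most one (`CoveringDimLE.prod_Icc`), so
that after division by `r` the cost is of order `1 / L`, which is arbitrarily small. The result is
`meanDim φ ≤ a * meanDim ψ` whenever `θ t x ≤ a t + b` for `t ≥ 0` (`IsTimeChange.meanDim_le`).
It is applied to `θ` with `a = M`, and to the inverse time change with `a = 1 / m`.
-/

/-! ### Covering dimension of a product with an interval -/

theorem CoveringDimLE.mono {P : Type*} [TopologicalSpace P] {n k : ℕ} (hP : CoveringDimLE P n)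
    (hnk : n ≤ k) : CoveringDimLE P k := by
  intro U hU hc
  obtain ⟨V, hV, hVc, hVU, hVn⟩ := hP U hU hc
  exact ⟨V, hV, hVc, hVU, fun x => (hVn x).trans (by gcongr)⟩

theorem coveringDim_le_iff {P : Type*} [TopologicalSpace P] {n : ℕ} :
    coveringDim P ≤ n ↔ CoveringDimLE P n := by
  constructor
  · intro h
    have h' : coveringDim P < ((n + 1 : ℕ) : ℕ∞) :=
      lt_of_le_of_lt h (by exact_mod_cast Nat.lt_succ_self n)
    simp only [coveringDim, iInf_lt_iff] at h'
    obtain ⟨k, hk, hkn⟩ := h'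
    exact hk.mono (Nat.lt_succ_iff.1 (by exact_mod_cast hkn))
  · intro h
    exact iInf₂_le n h

/-- The grids `i / m + ℤ` for `0 ≤ i < m` lie at distance at least `1 / m` from each other, so a
number is close to at most one of them. -/
theorem eq_of_near_int {m i i' : ℕ} (hi : i < m) (hi' : i' < m) {u : ℝ} {k k' : ℤ}
    (h : |u - i / m - k| < 1 / (4 * m)) (h' : |u - i' / m - k'| < 1 / (4 * m)) : i = i' := by
  have hm : (0 : ℝ) < m := by exact_mod_cast (Nat.zero_le i).trans_lt hi
  have e : |((i : ℝ) - i') + m * (k - k')| < 1 := by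
    have e1 : ((i : ℝ) - i') + m * (k - k') = m * ((u - i' / m - k') - (u - i / m - k)) := by
      field_simp
      ring
    rw [e1, abs_mul, abs_of_pos hm]
    calc (m : ℝ) * |(u - i' / m - k') - (u - i / m - k)|
        ≤ m * (|u - i' / m - k'| + |u - i / m - k|) := by gcongr; exact abs_sub _ _
      _ < m * (1 / (4 * m) + 1 / (4 * m)) := by gcongr
      _ = 1 / 2 := by field_simp; norm_num
      _ < 1 := by norm_num
  have e2 : |((i : ℤ) - i') + m * (k - k')| < 1 := by exact_mod_cast e
  rw [Int.abs_lt_one_iff] at e2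
  have h3 : (m : ℤ) ∣ (i : ℤ) - i' := ⟨k' - k, by linarith⟩
  have := Int.eq_zero_of_abs_lt_dvd h3 (by rw [abs_lt]; constructor <;> omega)
  omega

/-- The bricks `W i × (c i j - η, c i (j + 1) + η)`, where `c i j = j + i / m` and `η = 1 / (4 m)`,
cover a point at most once more than the sets `W i` do: the partitions `c i` of the line are shifted
against each other, so that a given height is close to a division point for at most one index
`i`. -/
theorem encard_bricks_le {P : Type*} {m n : ℕ} (W : Fin m → Set P) (p : P) (u : ℝ)
    (hW : {i | p ∈ W i}.encard ≤ n + 1) :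
    {q : Fin m × ℤ | p ∈ W q.1 ∧ (q.2 : ℝ) - 1 / (4 * m) < u - q.1 / m ∧
      u - q.1 / m < q.2 + 1 + 1 / (4 * m)}.encard ≤ n + 1 + 1 := by
  set S := {q : Fin m × ℤ | p ∈ W q.1 ∧ (q.2 : ℝ) - 1 / (4 * m) < u - q.1 / m ∧
      u - q.1 / m < q.2 + 1 + 1 / (4 * m)} with hS
  -- away from the floor of the height, both possible bricks end close to an integer
  have near : ∀ q ∈ S, q.2 ≠ ⌊u - q.1 / m⌋ →
      (q.2 = ⌊u - q.1 / m⌋ - 1 ∧ |u - q.1 / m - ⌊u - (q.1 : ℝ) / m⌋| < 1 / (4 * m)) ∨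
      (q.2 = ⌊u - q.1 / m⌋ + 1 ∧
        |u - q.1 / m - (⌊u - (q.1 : ℝ) / m⌋ + 1 : ℤ)| < 1 / (4 * m)) := by
    rintro ⟨i, j⟩ ⟨-, h1, h2⟩ hj
    simp only at h1 h2 hj ⊢
    have hm : (1 : ℝ) ≤ m := by exact_mod_cast i.pos
    have hη : 1 / (4 * (m : ℝ)) ≤ 1 / 4 := by
      apply one_div_le_one_div_of_le <;> linarith
    have f1 := Int.floor_le (u - (i : ℝ) / m)
    have f2 := Int.lt_floor_add_one (u - (i : ℝ) / m)
    set k := ⌊u - (i : ℝ) / m⌋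
    have a1 : (j : ℝ) < ((k + 2 : ℤ) : ℝ) := by push_cast; linarith
    have a2 : ((k - 2 : ℤ) : ℝ) < j := by push_cast; linarith
    rw [Int.cast_lt] at a1 a2
    rcases lt_or_gt_of_ne hj with h | h
    · left
      have : j = k - 1 := by omega
      subst this
      push_cast at h2
      refine ⟨rfl, ?_⟩
      rw [abs_lt]; constructor <;> linarith
    · right
      have : j = k + 1 := by omega
      subst this
      push_cast at h1 ⊢
      refine ⟨rfl, ?_⟩
      rw [abs_lt]; constructor <;> linarith
  have sub : S ⊆ (fun i : Fin m => (i, ⌊u - (i : ℝ) / m⌋)) '' {i | p ∈ W i} ∪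
      {q ∈ S | q.2 ≠ ⌊u - q.1 / m⌋} := by
    rintro ⟨i, j⟩ hq
    by_cases h : j = ⌊u - (i : ℝ) / m⌋
    · left; exact ⟨i, hq.1, by rw [h]⟩
    · right; exact ⟨hq, h⟩
  have one : {q ∈ S | q.2 ≠ ⌊u - q.1 / m⌋}.encard ≤ 1 := by
    rw [encard_le_one_iff]
    rintro ⟨i, j⟩ ⟨i', j'⟩ ⟨hq, hj⟩ ⟨hq', hj'⟩
    have hm : (1 : ℝ) ≤ m := by exact_mod_cast i.pos
    have hη : 1 / (4 * (m : ℝ)) ≤ 1 / 4 := by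
      apply one_div_le_one_div_of_le <;> linarith
    have hii : i = i' := by
      rcases near _ hq hj with ⟨-, h⟩ | ⟨-, h⟩ <;> rcases near _ hq' hj' with ⟨-, h'⟩ | ⟨-, h'⟩ <;>
        exact Fin.ext (eq_of_near_int i.2 i'.2 h h')
    subst hii
    rcases near _ hq hj with ⟨e, h⟩ | ⟨e, h⟩ <;> rcases near _ hq' hj' with ⟨e', h'⟩ | ⟨e', h'⟩ <;>
      simp only at e e' h h'
    · rw [e, e']
    · push_cast at h'
      rw [abs_lt] at h h'; linarith
    · push_cast at h
      rw [abs_lt] at h h'; linarith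
    · rw [e, e']
  calc S.encard ≤ _ := encard_le_encard sub
    _ ≤ _ := encard_union_le _ _
    _ ≤ _ := by gcongr; exact (encard_image_le _ _).trans hW

/-- Multiplying a compact metrizable space by an interval raises the covering dimension by at most
one. -/
theorem CoveringDimLE.prod_Icc {P : Type*} [TopologicalSpace P] [CompactSpace P]
    [TopologicalSpace.MetrizableSpace P] {n : ℕ} (hP : CoveringDimLE P n) (a b : ℝ) :
    CoveringDimLE (P × Icc a b) (n + 1) := by
  let := TopologicalSpace.metrizableSpaceMetric P
  intro U hU hc
  obtain ⟨δ, hδ, hball⟩ := lebesgue_number_lemma_of_metric_sUnion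
    (isCompact_univ (X := P × Icc a b)) hU hc.ge
  obtain ⟨V, hV, hVc, hVU, hVn⟩ := hP (range fun p : P => Metric.ball p (δ / 2))
    (by rintro _ ⟨p, rfl⟩; exact Metric.isOpen_ball)
    (eq_univ_of_forall fun p => ⟨_, ⟨p, rfl⟩, Metric.mem_ball_self (half_pos hδ)⟩)
  obtain ⟨T, hTV, hTf, hTc⟩ := isCompact_univ.elim_finite_subcover_image (c := id) hV
    (by rw [← hVc, sUnion_eq_biUnion]; rfl)
  obtain ⟨m, W, rfl⟩ := hTf.fin_embedding
  -- bricks of height a little more than `δ / 2`, shifted by the fraction `i / m` over `W i`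
  let B : Fin m × ℤ → Set (P × Icc a b) := fun q =>
    {z | z.1 ∈ W q.1 ∧ (q.2 : ℝ) - 1 / (4 * m) < (z.2 : ℝ) / (δ / 2) - q.1 / m ∧
      (z.2 : ℝ) / (δ / 2) - q.1 / m < q.2 + 1 + 1 / (4 * m)}
  refine ⟨{v | ∃ q, v = B q ∧ (B q).Nonempty}, ?_, ?_, ?_, ?_⟩
  · rintro _ ⟨q, rfl, -⟩
    have hW : IsOpen (W q.1) := hV _ (hTV ⟨_, rfl⟩)
    have hu : Continuous fun z : P × Icc a b => (z.2 : ℝ) / (δ / 2) - q.1 / m := by fun_prop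
    exact (hW.preimage continuous_fst).inter
      ((isOpen_lt continuous_const hu).inter (isOpen_lt hu continuous_const))
  · refine eq_univ_of_forall fun z => ?_
    obtain ⟨_, ⟨i, rfl⟩, hi⟩ := mem_iUnion₂.1 (hTc (mem_univ z.1))
    have hm : (0 : ℝ) < m := by exact_mod_cast i.pos
    have hη : 0 < 1 / (4 * (m : ℝ)) := by positivity
    have hz : z ∈ B (i, ⌊(z.2 : ℝ) / (δ / 2) - i / m⌋) := by
      refine ⟨hi, ?_, ?_⟩
      · linarith [Int.floor_le ((z.2 : ℝ) / (δ / 2) - (i : ℝ) / m)]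
      · linarith [Int.lt_floor_add_one ((z.2 : ℝ) / (δ / 2) - (i : ℝ) / m)]
    exact ⟨_, ⟨_, rfl, z, hz⟩, hz⟩
  · rintro _ ⟨⟨i, j⟩, rfl, z, hz⟩
    obtain ⟨u, hu, hzu⟩ := hball z (mem_univ z)
    refine ⟨u, hu, fun w hw => hzu ?_⟩
    obtain ⟨_, ⟨p, rfl⟩, hp⟩ := hVU _ (hTV ⟨i, rfl⟩)
    obtain ⟨hz0, hz1, hz2⟩ := hz
    obtain ⟨hw0, hw1, hw2⟩ := hw
    simp only at hz0 hz1 hz2 hw0 hw1 hw2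
    have hm : (1 : ℝ) ≤ m := by exact_mod_cast i.pos
    have hη : 1 / (4 * (m : ℝ)) ≤ 1 / 4 := by
      apply one_div_le_one_div_of_le <;> linarith
    rw [Metric.mem_ball, Prod.dist_eq, max_lt_iff]
    constructor
    · have h1 := Metric.mem_ball.1 (hp hz0)
      have h2 := Metric.mem_ball.1 (hp hw0)
      linarith [dist_triangle_right w.1 z.1 p]
    · have : |((w.2 : ℝ) - z.2) / (δ / 2)| < 2 := by
        rw [sub_div, abs_lt]; constructor <;> linarith
      rw [abs_div, abs_of_pos (half_pos hδ), div_lt_iff₀ (half_pos hδ)] at this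
      rw [Subtype.dist_eq, Real.dist_eq]
      linarith
  · intro z
    have hA : {i | z.1 ∈ W i}.encard ≤ n + 1 := by
      rw [← W.injective.encard_image]
      refine (encard_le_encard ?_).trans (hVn z.1)
      rintro _ ⟨i, hi, rfl⟩
      exact ⟨hTV ⟨i, rfl⟩, hi⟩
    have hsub : {v ∈ {v | ∃ q, v = B q ∧ (B q).Nonempty} | z ∈ v} ⊆ B '' {q | z ∈ B q} := by
      rintro _ ⟨⟨q, rfl, -⟩, hz⟩
      exact ⟨q, hz, rfl⟩
    push_cast
    exact ((encard_le_encard hsub).trans (encard_image_le _ _)).trans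
      (encard_bricks_le (fun i => W i) z.1 _ hA)

/-- Finitely many bounded real functions can be recorded alongside a map to a compact metrizable
space, at the cost of one dimension for each. -/
theorem exists_map_recording {X : Type*} [TopologicalSpace X] {P : Type} [TopologicalSpace P]
    [CompactSpace P] [TopologicalSpace.MetrizableSpace P] {n : ℕ} (hP : CoveringDimLE P n)
    {f : X → P} (hf : Continuous f) {a b : ℝ} (g : ℕ → X → Icc a b) (hg : ∀ k, Continuous (g k))
    (K : ℕ) :
    ∃ (Q : Type) (_ : TopologicalSpace Q) (_ : CompactSpace Q)
      (_ : TopologicalSpace.MetrizableSpace Q) (F : X → Q), CoveringDimLE Q (n + K) ∧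
      Continuous F ∧ ∀ x x', F x = F x' → f x = f x' ∧ ∀ k < K, g k x = g k x' := by
  induction K with
  | zero => exact ⟨P, _, ‹_›, ‹_›, f, hP, hf, fun x x' h => ⟨h, by simp⟩⟩
  | succ K ih =>
    obtain ⟨Q, _, _, _, F, hQ, hF, hinj⟩ := ih
    refine ⟨Q × Icc a b, inferInstance, inferInstance, inferInstance, fun x => (F x, g K x),
      hQ.prod_Icc a b, hF.prodMk (hg K), fun x x' h => ?_⟩
    obtain ⟨h1, h2⟩ := Prod.mk.inj h
    obtain ⟨h3, h4⟩ := hinj x x' h1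
    refine ⟨h3, fun k hk => ?_⟩
    rcases Nat.lt_succ_iff_lt_or_eq.1 hk with hk | rfl
    · exact h4 k hk
    · exact h2

theorem widim_le_coe {X : Type*} [TopologicalSpace X] {d : X → X → ℝ} {ε : ℝ} {P : Type}
    [TopologicalSpace P] [CompactSpace P] [TopologicalSpace.MetrizableSpace P] {n : ℕ}
    (hP : CoveringDimLE P n) {f : X → P} (hf : Continuous f)
    (hd : ∀ x x', f x = f x' → d x x' ≤ ε) : widim d ε ≤ n :=
  le_trans (b := coveringDim P) (sInf_le ⟨P, _, ‹_›, ‹_›, f, hf, hd, rfl⟩)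
    (coveringDim_le_iff.2 hP)

theorem exists_map_of_widim_eq {X : Type*} [TopologicalSpace X] {d : X → X → ℝ} {ε : ℝ} {n : ℕ}
    (h : widim d ε = n) :
    ∃ (P : Type) (_ : TopologicalSpace P) (_ : CompactSpace P)
      (_ : TopologicalSpace.MetrizableSpace P) (f : X → P), CoveringDimLE P n ∧ Continuous f ∧
      ∀ x x', f x = f x' → d x x' ≤ ε := by
  have hne : {k : ℕ∞ | ∃ (P : Type) (_ : TopologicalSpace P) (_ : CompactSpace P)
      (_ : TopologicalSpace.MetrizableSpace P) (f : X → P), Continuous f ∧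
        (∀ x x', f x = f x' → d x x' ≤ ε) ∧ coveringDim P = k}.Nonempty := by
    by_contra hne
    rw [widim, not_nonempty_iff_eq_empty.1 hne, sInf_empty] at h
    exact ENat.natCast_ne_top n h.symm
  obtain ⟨P, i1, i2, i3, f, hf, hd, hP⟩ := csInf_mem hne
  exact ⟨P, i1, i2, i3, f, coveringDim_le_iff.1 (hP.trans h).le, hf, hd⟩

/-! ### Comparison of mean dimensions under a time change -/

theorem dist_le_bowenDist {X : Type*} [MetricSpace X] [CompactSpace X] (φ : Flow ℝ X) {r t : ℝ}
    (h0 : 0 ≤ t) (ht : t ≤ r) (x x' : X) : dist (φ t x) (φ t x') ≤ bowenDist φ r x x' := by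
  refine le_ciSup (f := fun t : Icc (0 : ℝ) r => dist (φ t x) (φ t x')) ?_ ⟨t, h0, ht⟩
  refine ⟨Metric.diam (univ : Set X), ?_⟩
  rintro _ ⟨s, rfl⟩
  exact Metric.dist_le_diam_of_mem isCompact_univ.isBounded (mem_univ _) (mem_univ _)

theorem bowenDist_le {X : Type*} [MetricSpace X] (φ : Flow ℝ X) {r ε : ℝ}
    (hr : 0 ≤ r) {x x' : X} (h : ∀ t, 0 ≤ t → t ≤ r → dist (φ t x) (φ t x') ≤ ε) :
    bowenDist φ r x x' ≤ ε := by
  have : Nonempty (Icc (0 : ℝ) r) := ⟨⟨0, le_rfl, hr⟩⟩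
  exact ciSup_le fun t => h t t.2.1 t.2.2

/-- Closeness in `Y` controls closeness in `X` along orbit pieces of bounded length. -/
theorem exists_delta_dist_le {X Y : Type*} [MetricSpace X] [CompactSpace X] [MetricSpace Y]
    [CompactSpace Y] (φ : Flow ℝ X) (π : X ≃ₜ Y) (L : ℝ) {ε : ℝ} (hε : 0 < ε) :
    ∃ δ > 0, ∀ x x', dist (π x) (π x') ≤ δ → ∀ t, 0 ≤ t → t ≤ L →
      dist (φ t x) (φ t x') ≤ ε := by
  have huc : UniformContinuous fun p : Icc (0 : ℝ) L × Y => φ p.1 (π.symm p.2) :=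
    CompactSpace.uniformContinuous_of_continuous
      (φ.continuous (by fun_prop) (π.symm.continuous.comp continuous_snd))
  obtain ⟨δ, hδ, h⟩ := Metric.uniformContinuous_iff.1 huc ε hε
  refine ⟨δ / 2, half_pos hδ, fun x x' hx t h0 ht => ?_⟩
  have := @h (⟨t, h0, ht⟩, π x) (⟨t, h0, ht⟩, π x') (by
    rw [Prod.dist_eq, dist_self, max_lt_iff]
    exact ⟨hδ, hx.trans_lt (half_lt_self hδ)⟩)
  simpa using this.le

namespace IsTimeChange

variable {X Y : Type*} [MetricSpace X] [MetricSpace Y] {φ : Flow ℝ X} {ψ : Flow ℝ Y}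
  {π : X ≃ₜ Y} {θ : ℝ → X → ℝ}

theorem nonneg (hθ : IsTimeChange φ ψ π θ) {t : ℝ} (ht : 0 ≤ t) (x : X) : 0 ≤ θ t x := by
  have := (hθ.strictMono x).monotone ht
  simpa [hθ.zero] using this

theorem continuous_apply (hθ : IsTimeChange φ ψ π θ) (t : ℝ) : Continuous (θ t) :=
  hθ.continuous.comp (Continuous.prodMk_right t)

variable [CompactSpace X] [CompactSpace Y] [Nonempty X]

/-- The key estimate: a map fine enough for the Bowen distance of `ψ` on `[0, R]`, together with the
elapsed times `θ (k L)` for `k ≤ r / L`, determines the orbit piece over `[0, r]` up to `ε`.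
At the times `k L` the images in `Y` of two points with the same data are reached at a common time
of `ψ`, so that a drift of the time change is forgotten at each of these times. -/
theorem widim_bowenDist_le (hθ : IsTimeChange φ ψ π θ) {L ε : ℝ} (hL : 0 < L) (hε : 0 < ε) :
    ∃ δ > 0, ∀ r R, 0 ≤ r → (∀ t x, 0 ≤ t → t ≤ r → θ t x ≤ R) →
      widim (bowenDist φ r) ε ≤ widim (bowenDist ψ R) δ + (⌊r / L⌋₊ + 1 : ℕ) := by
  obtain ⟨δ, hδ, hδL⟩ := exists_delta_dist_le φ π L hε
  refine ⟨δ, hδ, fun r R hr hR => ?_⟩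
  obtain ⟨x₀⟩ := ‹Nonempty X›
  have hR0 : 0 ≤ R := (hθ.nonneg hr x₀).trans (hR r x₀ hr le_rfl)
  cases hw : widim (bowenDist ψ R) δ with
  | top => simp
  | coe n =>
    obtain ⟨P, _, _, _, f, hP, hf, hd⟩ := exists_map_of_widim_eq hw
    obtain ⟨Q, _, _, _, F, hQ, hF, hinj⟩ := exists_map_recording hP (hf.comp π.continuous)
      (fun k x => projIcc 0 R hR0 (θ (k * L) x))
      (fun k => continuous_projIcc.comp (hθ.continuous_apply _)) (⌊r / L⌋₊ + 1)
    refine (widim_le_coe hQ hF fun x x' hx => bowenDist_le φ hr fun t h0 ht => ?_).trans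
      (by push_cast; exact le_rfl)
    obtain ⟨h1, h2⟩ := hinj x x' hx
    have hk : ⌊t / L⌋₊ < ⌊r / L⌋₊ + 1 :=
      Nat.lt_succ_of_le (Nat.floor_le_floor (by gcongr))
    set k := ⌊t / L⌋₊
    have hkt : k * L ≤ t := (le_div_iff₀ hL).1 (Nat.floor_le (by positivity))
    have htk : t < (k + 1) * L := (div_lt_iff₀ hL).1 (Nat.lt_floor_add_one _)
    have hkL : 0 ≤ k * L := by positivity
    have hmem : ∀ y, θ (k * L) y ∈ Icc 0 R := fun y =>
      ⟨hθ.nonneg hkL y, hR _ y hkL (hkt.trans ht)⟩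
    have hs : θ (k * L) x = θ (k * L) x' := by
      have := congrArg Subtype.val (h2 k hk)
      simpa only [projIcc_of_mem hR0 (hmem _)] using this
    have hc : dist (π (φ (k * L) x)) (π (φ (k * L) x')) ≤ δ := by
      rw [← hθ.conj, ← hθ.conj, ← hs]
      exact (dist_le_bowenDist ψ (hmem x).1 (hmem x).2 _ _).trans (hd _ _ h1)
    have := hδL _ _ hc (t - k * L) (by linarith) (by linarith)
    simpa only [← Flow.map_add, sub_add_cancel] using this

/-- A time change of asymptotic speed at most `a` enlarges mean dimension at most by the
factor `a`. -/
theorem meanDim_le (hθ : IsTimeChange φ ψ π θ) {a b : ℝ} (ha : 0 < a)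
    (hab : ∀ t x, 0 ≤ t → θ t x ≤ a * t + b) : meanDim φ ≤ ENNReal.ofReal a * meanDim ψ := by
  -- recording times at distance `n + 1` costs the second summand, which vanishes as `n → ∞`
  have key : ∀ n : ℕ, meanDim φ ≤ ENNReal.ofReal (a + 1 / (n + 1)) * meanDim ψ +
      ENNReal.ofReal (2 * (1 / ((n : ℝ) + 1))) := by
    intro n
    have hL : (0 : ℝ) < n + 1 := by positivity
    set a' := a + 1 / ((n : ℝ) + 1) with ha'
    have haa' : 0 < a' - a := by rw [ha', add_sub_cancel_left]; positivity
    have ha'0 : 0 < a' := by linarith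
    refine iSup₂_le fun ε hε => ?_
    obtain ⟨δ, hδ, hw⟩ := hθ.widim_bowenDist_le hL hε
    let G : ℝ → ℝ≥0∞ := fun R => ((widim (bowenDist ψ R) δ : ℕ∞) : ℝ≥0∞) / ENNReal.ofReal R
    have hev : ∀ᶠ r : ℝ in atTop,
        ((widim (bowenDist φ r) ε : ℕ∞) : ℝ≥0∞) / ENNReal.ofReal r ≤
          ENNReal.ofReal a' * G (a' * r) + ENNReal.ofReal (2 * (1 / ((n : ℝ) + 1))) := by
      filter_upwards [eventually_ge_atTop ((n : ℝ) + 1),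
        eventually_ge_atTop (|b| / (a' - a))] with r hr1 hr2
      have hr0 : 0 < r := hL.trans_le hr1
      have hb : a * r + b ≤ a' * r := by
        rw [div_le_iff₀ haa'] at hr2
        linarith [le_abs_self b]
      have hle := hw r (a' * r) hr0.le fun t x h0 ht =>
        (hab t x h0).trans ((add_le_add_left (mul_le_mul_of_nonneg_left ht ha.le) b).trans hb)
      have hle' : ((widim (bowenDist φ r) ε : ℕ∞) : ℝ≥0∞) ≤
          ((widim (bowenDist ψ (a' * r)) δ : ℕ∞) : ℝ≥0∞) +
            ENNReal.ofReal ((⌊r / (n + 1)⌋₊ + 1 : ℕ) : ℝ) := by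
        rw [ENNReal.ofReal_natCast]
        exact_mod_cast hle
      refine (ENNReal.div_le_div_right hle' _).trans ?_
      rw [ENNReal.add_div]
      refine add_le_add (le_of_eq ?_) ?_
      · have h1 : ENNReal.ofReal a' ≠ 0 := by simpa using ha'0
        simp only [G]
        rw [ENNReal.ofReal_mul ha'0.le, ← mul_div_assoc,
          ENNReal.mul_div_mul_left _ _ h1 ENNReal.ofReal_ne_top]
      · rw [← ENNReal.ofReal_div_of_pos hr0]
        refine ENNReal.ofReal_le_ofReal ?_
        rw [div_le_iff₀ hr0]
        push_cast
        have h1 : (⌊r / ((n : ℝ) + 1)⌋₊ : ℝ) ≤ r / (n + 1) := Nat.floor_le (by positivity)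
        have h2 : 1 ≤ r / ((n : ℝ) + 1) := (one_le_div hL).2 hr1
        calc (⌊r / ((n : ℝ) + 1)⌋₊ : ℝ) + 1 ≤ r / (n + 1) + r / (n + 1) := add_le_add h1 h2
          _ = 2 * (1 / ((n : ℝ) + 1)) * r := by ring
    have hG : limsup (fun r => G (a' * r)) atTop ≤ meanDim ψ :=
      (Tendsto.limsup_comp_le_limsup (tendsto_id.const_mul_atTop ha'0)).trans
        (le_iSup₂ (f := fun (ε : ℝ) (_ : 0 < ε) => limsup (fun r : ℝ =>
          ((widim (bowenDist ψ r) ε : ℕ∞) : ℝ≥0∞) / ENNReal.ofReal r) atTop) δ hδ)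
    calc _ ≤ limsup (fun r => ENNReal.ofReal a' * G (a' * r) +
          ENNReal.ofReal (2 * (1 / ((n : ℝ) + 1)))) atTop := limsup_le_limsup hev
      _ = ENNReal.ofReal a' * limsup (fun r => G (a' * r)) atTop +
          ENNReal.ofReal (2 * (1 / ((n : ℝ) + 1))) := by
        rw [limsup_add_const (atTop : Filter ℝ) _ _ (by isBoundedDefault) (by isBoundedDefault),
          ENNReal.limsup_const_mul_of_ne_top ENNReal.ofReal_ne_top]
      _ ≤ _ := by gcongr
  have h1 : Tendsto (fun n : ℕ => ENNReal.ofReal (a + 1 / ((n : ℝ) + 1))) atTop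
      (𝓝 (ENNReal.ofReal a)) := by
    refine ENNReal.tendsto_ofReal ?_
    simpa using tendsto_one_div_add_atTop_nhds_zero_nat.const_add a
  have h2 : Tendsto (fun n : ℕ => ENNReal.ofReal (2 * (1 / ((n : ℝ) + 1)))) atTop (𝓝 0) := by
    rw [← ENNReal.ofReal_zero]
    refine ENNReal.tendsto_ofReal ?_
    simpa using tendsto_one_div_add_atTop_nhds_zero_nat.const_mul (2 : ℝ)
  have h3 := (ENNReal.Tendsto.mul_const (b := meanDim ψ) h1 (Or.inl (by simpa using ha))).add h2
  rw [add_zero] at h3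
  exact ge_of_tendsto' h3 key

end IsTimeChange

/-! ### Existence and uniqueness of the time change -/

/-- On a compact space the periods of a flow without fixed points are bounded away from zero:
multiples of a small period come close to every time, whereas some open interval of times moves
all points near a given one. -/
theorem NoFixedPoint.exists_period_bound {Y : Type*} [MetricSpace Y] [CompactSpace Y]
    {ψ : Flow ℝ Y} (hψ : NoFixedPoint ψ) :
    ∃ τ > 0, ∀ s y, |s| < τ → ψ s y = y → s = 0 := by
  have key : ∀ y ∈ (univ : Set Y), ∀ᶠ z : ℝ × Y in 𝓝 (0, y), ψ z.1 z.2 = z.2 → z.1 = 0 := by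
    intro y _
    obtain ⟨t, ht⟩ := hψ y
    have ho : ∀ᶠ z : ℝ × Y in 𝓝 (t, y), ψ z.1 z.2 ≠ z.2 :=
      (isOpen_ne_fun (ψ.continuous continuous_fst continuous_snd) continuous_snd).mem_nhds ht
    rw [nhds_prod_eq, eventually_prod_iff] at ho
    obtain ⟨p, hp, q, hq, hpq⟩ := ho
    obtain ⟨δ, hδ, hpδ⟩ := Metric.eventually_nhds_iff.1 hp
    rw [nhds_prod_eq, eventually_prod_iff]
    refine ⟨fun s => dist s 0 < δ, Metric.ball_mem_nhds 0 hδ, q, hq, fun {s} hs {y'} hy' hper => ?_⟩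
    by_contra hs0
    simp only at hs hper hs0
    have hmul : ∀ k : ℤ, ψ (k * s) y' = y' := by
      have hnat : ∀ k : ℕ, ψ (k * s) y' = y' := by
        intro k
        induction k with
        | zero => simp [Flow.map_zero_apply]
        | succ k ih =>
          rw [Nat.cast_succ, add_mul, one_mul, Flow.map_add, hper, ih]
      intro k
      obtain ⟨n, rfl | rfl⟩ := k.eq_nat_or_neg
      · exact_mod_cast hnat n
      · have h1 := congrArg (ψ (-(n * s))) (hnat n)
        rw [← Flow.map_add, neg_add_cancel, Flow.map_zero_apply] at h1
        push_cast
        rw [neg_mul]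
        exact h1.symm
    refine hpq (hpδ (y := ⌊t / s⌋ * s) ?_) hy' (hmul _)
    have e : ⌊t / s⌋ * s - t = -(Int.fract (t / s) * s) := by
      rw [Int.fract, sub_mul, div_mul_cancel₀ t hs0]; ring
    rw [Real.dist_eq, sub_zero] at hs
    rw [Real.dist_eq, e, abs_neg, abs_mul, abs_of_nonneg (Int.fract_nonneg _)]
    exact (mul_le_of_le_one_left (abs_nonneg s) (Int.fract_lt_one _).le).trans_lt hs
  have := isCompact_univ.eventually_forall_of_forall_eventually
    (P := fun s y => ψ s y = y → s = 0) key
  obtain ⟨τ, hτ, h⟩ := Metric.eventually_nhds_iff.1 this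
  exact ⟨τ, hτ, fun s y hs => h (by simpa using hs) y (mem_univ y)⟩

theorem exists_abs_eq {g : ℝ → ℝ} (hg : Continuous g) {s t γ : ℝ} (h0 : g s = 0)
    (hγ : 0 ≤ γ) (ht : γ ≤ |g t|) : ∃ u ∈ uIcc s t, |g u| = γ := by
  have := intermediate_value_uIcc (f := fun u => |g u|) (a := s) (b := t)
    (hg.abs.continuousOn)
  exact this (by rw [h0, abs_zero]; exact Icc_subset_uIcc ⟨hγ, ht⟩)

/-- Two continuous time changes along one orbit agree: their difference takes values in the
periods of the image point, which form a discrete set. -/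
theorem NoFixedPoint.lift_unique {Y : Type*} [MetricSpace Y] [CompactSpace Y]
    {ψ : Flow ℝ Y} (hψ : NoFixedPoint ψ) {g h : ℝ → ℝ} (hg : Continuous g) (hh : Continuous h)
    (hg0 : g 0 = 0) (hh0 : h 0 = 0) {y : Y} (hgh : ∀ t, ψ (g t) y = ψ (h t) y) : g = h := by
  obtain ⟨τ, hτ, hper⟩ := hψ.exists_period_bound
  have hfix : ∀ t, ψ (g t - h t) y = y := by
    intro t
    rw [sub_eq_neg_add, Flow.map_add, hgh, ← Flow.map_add, neg_add_cancel, Flow.map_zero_apply]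
  funext t
  by_contra hne
  have hpos : 0 < |g t - h t| := abs_pos.2 (sub_ne_zero.2 hne)
  obtain ⟨u, -, hu⟩ := exists_abs_eq (hg.sub hh) (s := 0) (t := t)
    (γ := min (|g t - h t|) (τ / 2)) (by simp [hg0, hh0]) (by positivity) (min_le_left _ _)
  rw [Pi.sub_apply] at hu
  have h1 := hper _ y (by rw [hu]; exact (min_le_right _ _).trans_lt (half_lt_self hτ)) (hfix u)
  rw [h1, abs_zero] at hu
  have : 0 < min (|g t - h t|) (τ / 2) := by positivity
  linarith

/-- A weak equivalence between compact flows without fixed points comes with a time change. The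
main point is joint continuity. For short times the time change is small, since a time of
modulus `γ` for `ψ` moves all points when `γ` is less than all periods; a small value is determined
by the end points, which makes it continuous. The cocycle identity extends continuity to all
times. -/
theorem IsWeakEquivalence.exists_isTimeChange {X Y : Type*} [MetricSpace X] [CompactSpace X]
    [MetricSpace Y] [CompactSpace Y] {φ : Flow ℝ X} {ψ : Flow ℝ Y} {π : X ≃ₜ Y}
    (hπ : IsWeakEquivalence φ ψ π) (hψ : NoFixedPoint ψ) : ∃ θ, IsTimeChange φ ψ π θ := by
  choose h hh using hπ
  have hback : ∀ x, ψ (-h x 0) (π x) = π x := by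
    intro x
    have h0 := hh x 0
    rw [Flow.map_zero_apply] at h0
    conv_lhs => rw [h0]
    rw [← Flow.map_add, neg_add_cancel, Flow.map_zero_apply]
  -- `h x 0` need not vanish, but it is a period of `π x`
  let θ : ℝ → X → ℝ := fun t x => h x t - h x 0
  have conj : ∀ t x, ψ (θ t x) (π x) = π (φ t x) := by
    intro t x
    simp only [θ]
    rw [sub_eq_add_neg, Flow.map_add, hback, hh]
  have zero : ∀ x, θ 0 x = 0 := fun x => sub_self _
  have mono : ∀ x, StrictMono fun t => θ t x := fun x s t hst =>
    sub_lt_sub_right ((h x).strictMono hst) _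
  have cont : ∀ x, Continuous fun t => θ t x := fun x => (h x).continuous.sub continuous_const
  have cocycle : ∀ t' t x, θ (t' + t) x = θ t' (φ t x) + θ t x := by
    intro t' t x
    have := hψ.lift_unique (g := fun s => θ (s + t) x - θ t x) (h := fun s => θ s (φ t x))
      (y := π (φ t x)) (((cont x).comp (by fun_prop)).sub continuous_const) (cont _)
      (by simp) (zero _) fun s => by
        rw [conj, ← Flow.map_add, ← conj t x, ← Flow.map_add, sub_add_cancel, conj]
    linarith [congrFun this t']
  obtain ⟨τ, hτ, hper⟩ := hψ.exists_period_bound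
  obtain ⟨γ, hγ, hγτ⟩ : ∃ γ, 0 < γ ∧ 2 * γ < τ := ⟨τ / 4, by positivity, by linarith⟩
  have hev : ∀ᶠ t : ℝ in 𝓝 0, ∀ x ∈ (univ : Set X),
      π (φ t x) ≠ ψ γ (π x) ∧ π (φ t x) ≠ ψ (-γ) (π x) := by
    refine isCompact_univ.eventually_forall_of_forall_eventually fun x _ => ?_
    have hne : ∀ s, |s| = γ → ∀ᶠ z : ℝ × X in 𝓝 (0, x), π (φ z.1 z.2) ≠ ψ s (π z.2) := by
      intro s hs
      refine (isOpen_ne_fun (π.continuous.comp (φ.continuous continuous_fst continuous_snd))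
        (ψ.continuous continuous_const (π.continuous.comp continuous_snd))).mem_nhds ?_
      change π (φ 0 x) ≠ ψ s (π x)
      rw [Flow.map_zero_apply]
      intro he
      have := hper s _ (by linarith) he.symm
      rw [this, abs_zero] at hs
      exact hγ.ne hs
    exact (hne γ (abs_of_pos hγ)).and (hne (-γ) (by rw [abs_neg, abs_of_pos hγ]))
  obtain ⟨T, hT, hTγ⟩ := Metric.eventually_nhds_iff.1 hev
  have small : ∀ t x, |t| < T → |θ t x| < γ := by
    intro t x ht
    by_contra! hge
    obtain ⟨u, hu, huγ⟩ := exists_abs_eq (cont x) (s := 0) (t := t) (zero x) hγ.le hge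
    have hut : |u| < T := by
      have := abs_sub_left_of_mem_uIcc hu
      rw [sub_zero, sub_zero] at this
      exact this.trans_lt ht
    have hu2 := hTγ (y := u) (by simpa using hut) x (mem_univ x)
    rcases (abs_eq hγ.le).1 huγ with e | e
    · exact hu2.1 (by rw [← conj, e])
    · exact hu2.2 (by rw [← conj, e])
  have cont_small : ∀ p : ℝ × X, |p.1| < T → ContinuousAt (fun p : ℝ × X => θ p.1 p.2) p := by
    rintro ⟨t₀, x₀⟩ ht₀
    simp only at ht₀
    rw [Metric.continuousAt_iff']
    intro ε hε
    have hK : IsCompact (Icc (-γ) γ \ Metric.ball (θ t₀ x₀) ε) :=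
      isCompact_Icc.diff Metric.isOpen_ball
    have hne : ∀ᶠ z : ℝ × X in 𝓝 (t₀, x₀), ∀ s ∈ Icc (-γ) γ \ Metric.ball (θ t₀ x₀) ε,
        ψ s (π z.2) ≠ π (φ z.1 z.2) := by
      refine hK.eventually_forall_of_forall_eventually fun s hs => ?_
      refine (isOpen_ne_fun (f := fun z : (ℝ × X) × ℝ => ψ z.2 (π z.1.2))
        (g := fun z => π (φ z.1.1 z.1.2))
        (ψ.continuous continuous_snd (π.continuous.comp (by fun_prop)))
        (π.continuous.comp (φ.continuous (by fun_prop) (by fun_prop)))).mem_nhds ?_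
      change ψ s (π x₀) ≠ π (φ t₀ x₀)
      rw [← conj]
      intro he
      have hfix : ψ (s - θ t₀ x₀) (π x₀) = π x₀ := by
        rw [sub_eq_neg_add, Flow.map_add, he, ← Flow.map_add, neg_add_cancel, Flow.map_zero_apply]
      have hsm := abs_lt.1 (small t₀ x₀ ht₀)
      have := hper _ _ (by rw [abs_lt]; constructor <;> linarith [hs.1.1, hs.1.2]) hfix
      rw [sub_eq_zero] at this
      exact hs.2 (this ▸ Metric.mem_ball_self hε)
    have hTn : ∀ᶠ z : ℝ × X in 𝓝 (t₀, x₀), |z.1| < T :=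
      (isOpen_lt (continuous_fst.abs) continuous_const).mem_nhds ht₀
    filter_upwards [hne, hTn] with z hz hzT
    by_contra hd
    have hsm := abs_lt.1 (small z.1 z.2 hzT)
    exact hz _ ⟨⟨hsm.1.le, hsm.2.le⟩, hd⟩ (conj _ _)
  have cont_pow : ∀ n : ℕ, ∀ p : ℝ × X, |p.1| < 2 ^ n * T →
      ContinuousAt (fun p : ℝ × X => θ p.1 p.2) p := by
    intro n
    induction n with
    | zero => simpa using cont_small
    | succ n ih =>
      intro p hp
      have hp2 : |p.1 / 2| < 2 ^ n * T := by
        rw [abs_div, abs_two, div_lt_iff₀ two_pos]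
        rw [pow_succ] at hp; linarith
      have e : (fun p : ℝ × X => θ p.1 p.2) =
          fun p => θ (p.1 / 2) (φ (p.1 / 2) p.2) + θ (p.1 / 2) p.2 := by
        funext p
        rw [← cocycle, add_halves]
      rw [e]
      have hc : Continuous fun p : ℝ × X => p.1 / 2 := by fun_prop
      exact (ContinuousAt.comp (g := fun p : ℝ × X => θ p.1 p.2)
          (f := fun p : ℝ × X => (p.1 / 2, φ (p.1 / 2) p.2)) (ih _ hp2)
          (hc.prodMk (φ.continuous hc continuous_snd)).continuousAt).add
        (ContinuousAt.comp (g := fun p : ℝ × X => θ p.1 p.2)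
          (f := fun p : ℝ × X => (p.1 / 2, p.2)) (ih _ hp2) (hc.prodMk continuous_snd).continuousAt)
  refine ⟨θ, conj, zero, mono, cocycle, continuous_iff_continuousAt.2 fun p => ?_⟩
  obtain ⟨n, hn⟩ := pow_unbounded_of_one_lt (|p.1| / T) one_lt_two
  exact cont_pow n p ((div_lt_iff₀ hT).1 hn)

/-! ### Growth and inversion of the time change -/

theorem IsWeakEquivalence.symm {X Y : Type*} [TopologicalSpace X] [TopologicalSpace Y]
    {φ : Flow ℝ X} {ψ : Flow ℝ Y} {π : X ≃ₜ Y} (hπ : IsWeakEquivalence φ ψ π) :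
    IsWeakEquivalence ψ φ π.symm := by
  intro y
  obtain ⟨h, hh⟩ := hπ (π.symm y)
  refine ⟨h.symm, fun s => ?_⟩
  rw [Homeomorph.symm_apply_eq, hh, OrderIso.apply_symm_apply, Homeomorph.apply_symm_apply]

namespace IsTimeChange

variable {X Y : Type*} [MetricSpace X] [MetricSpace Y] {φ : Flow ℝ X} {ψ : Flow ℝ Y}
  {π : X ≃ₜ Y} {θ : ℝ → X → ℝ}

theorem natCast_le (hθ : IsTimeChange φ ψ π θ) {M : ℝ} (hM : ∀ x, θ 1 x ≤ M) (n : ℕ) (x : X) :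
    θ n x ≤ n * M := by
  induction n with
  | zero => simp [hθ.zero]
  | succ n ih =>
    rw [Nat.cast_succ, add_comm, hθ.cocycle]
    linarith [hM (φ n x)]

theorem le_natCast (hθ : IsTimeChange φ ψ π θ) {m : ℝ} (hm : ∀ x, m ≤ θ 1 x) (n : ℕ) (x : X) :
    n * m ≤ θ n x := by
  induction n with
  | zero => simp [hθ.zero]
  | succ n ih =>
    rw [Nat.cast_succ, add_comm, hθ.cocycle]
    linarith [hm (φ n x)]

theorem le_mul_add (hθ : IsTimeChange φ ψ π θ) {M : ℝ} (hM : ∀ x, θ 1 x ≤ M) (hM0 : 0 ≤ M)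
    {t : ℝ} (ht : 0 ≤ t) (x : X) : θ t x ≤ M * t + M := by
  have h1 : θ t x ≤ θ (⌊t⌋₊ + 1 : ℕ) x :=
    (hθ.strictMono x).monotone (by push_cast; exact (Nat.lt_floor_add_one t).le)
  have h2 := hθ.natCast_le hM (⌊t⌋₊ + 1) x
  have h3 : (⌊t⌋₊ : ℝ) * M ≤ t * M := by gcongr; exact Nat.floor_le ht
  push_cast at h2
  push_cast at h1
  linarith

theorem mul_sub_le (hθ : IsTimeChange φ ψ π θ) {m : ℝ} (hm : ∀ x, m ≤ θ 1 x) (hm0 : 0 ≤ m)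
    {t : ℝ} (ht : 0 ≤ t) (x : X) : m * t - m ≤ θ t x := by
  have h1 : θ ⌊t⌋₊ x ≤ θ t x := (hθ.strictMono x).monotone (Nat.floor_le ht)
  have h2 := hθ.le_natCast hm ⌊t⌋₊ x
  have h3 : t * m ≤ (⌊t⌋₊ + 1) * m := by gcongr; exact (Nat.lt_floor_add_one t).le
  linarith

/-- The time changes induced by `π` and by `π.symm` are mutually inverse along each orbit. -/
theorem apply_symm [CompactSpace Y] (hψ : NoFixedPoint ψ) (hθ : IsTimeChange φ ψ π θ)
    {θ' : ℝ → Y → ℝ} (hθ' : IsTimeChange ψ φ π.symm θ') (s : ℝ) (y : Y) :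
    θ (θ' s y) (π.symm y) = s := by
  refine congrFun (hψ.lift_unique (g := fun s => θ (θ' s y) (π.symm y)) (h := id) (y := y) ?_
    continuous_id ?_ rfl fun t => ?_) s
  · exact (hθ.continuous.comp (Continuous.prodMk_left _)).comp
      (hθ'.continuous.comp (Continuous.prodMk_left y))
  · simp [hθ.zero, hθ'.zero]
  · have := hθ.conj (θ' t y) (π.symm y)
    rw [hθ'.conj, Homeomorph.apply_symm_apply, Homeomorph.apply_symm_apply] at this
    exact this

theorem unique [CompactSpace Y] (hψ : NoFixedPoint ψ) (hθ : IsTimeChange φ ψ π θ)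
    {θ' : ℝ → X → ℝ} (hθ' : IsTimeChange φ ψ π θ') : θ' = θ := by
  funext t x
  exact congrFun (hψ.lift_unique (g := fun t => θ' t x) (h := fun t => θ t x) (y := π x)
    (hθ'.continuous.comp (Continuous.prodMk_left x))
    (hθ.continuous.comp (Continuous.prodMk_left x)) (hθ'.zero x) (hθ.zero x)
    fun t => by rw [hθ.conj, hθ'.conj]) t

end IsTimeChange

/-! ### Proportionality of mean dimensions -/

/-- Two extended nonnegative numbers comparable up to positive constants are proportional. -/
theorem ENNReal.exists_eq_ofReal_mul {a b : ℝ≥0∞} {m M : ℝ} (hm : 0 < m)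
    (h1 : ENNReal.ofReal m * b ≤ a) (h2 : a ≤ ENNReal.ofReal M * b) :
    ∃ C : ℝ, 0 < C ∧ a = ENNReal.ofReal C * b := by
  have hm' : ENNReal.ofReal m ≠ 0 := by simpa using hm
  by_cases hb0 : b = 0
  · subst hb0
    exact ⟨1, one_pos, by simpa using h2⟩
  by_cases hbt : b = ⊤
  · subst hbt
    rw [ENNReal.mul_top hm', top_le_iff] at h1
    exact ⟨1, one_pos, by simp [h1]⟩
  have ha0 : a ≠ 0 := (pos_iff_ne_zero.2 (mul_ne_zero hm' hb0)).trans_le h1 |>.ne'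
  have hat : a ≠ ⊤ := (h2.trans_lt (ENNReal.mul_lt_top ENNReal.ofReal_lt_top
    (lt_top_iff_ne_top.2 hbt))).ne
  have hab : a / b ≠ ⊤ := ENNReal.div_ne_top hat hb0
  refine ⟨(a / b).toReal, ENNReal.toReal_pos (ENNReal.div_ne_zero.2 ⟨ha0, hbt⟩) hab, ?_⟩
  rw [ENNReal.ofReal_toReal hab, ENNReal.div_mul_cancel hb0 hbt]

theorem mainTheorem2 {X Y : Type*} [MetricSpace X] [CompactSpace X] [Nonempty X]
    [MetricSpace Y] [CompactSpace Y] (φ : Flow ℝ X) (ψ : Flow ℝ Y)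
    (hφ : NoFixedPoint φ) (hψ : NoFixedPoint ψ)
    (π : X ≃ₜ Y) (hπ : IsWeakEquivalence φ ψ π) :
    ∃ θ : ℝ → X → ℝ, IsTimeChange φ ψ π θ ∧ (∀ θ', IsTimeChange φ ψ π θ' → θ' = θ) ∧
      ∃ m M : ℝ, IsLeast (range (θ 1)) m ∧ IsGreatest (range (θ 1)) M ∧ 0 < m ∧ m ≤ M ∧
        ENNReal.ofReal m * meanDim ψ ≤ meanDim φ ∧
        meanDim φ ≤ ENNReal.ofReal M * meanDim ψ ∧
        ∃ C : ℝ, 0 < C ∧ meanDim φ = ENNReal.ofReal C * meanDim ψ := by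
  obtain ⟨θ, hθ⟩ := hπ.exists_isTimeChange hψ
  obtain ⟨θ', hθ'⟩ := hπ.symm.exists_isTimeChange hφ
  have hc : IsCompact (range (θ 1)) := isCompact_range (hθ.continuous_apply 1)
  obtain ⟨m, hm⟩ := hc.exists_isLeast (range_nonempty _)
  obtain ⟨M, hM⟩ := hc.exists_isGreatest (range_nonempty _)
  have hm0 : 0 < m := by
    obtain ⟨x, rfl⟩ := hm.1
    simpa [hθ.zero] using hθ.strictMono x one_pos
  have hmM : m ≤ M := hm.2 hM.1
  have hM0 : 0 < M := hm0.trans_le hmM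
  have upper : meanDim φ ≤ ENNReal.ofReal M * meanDim ψ :=
    hθ.meanDim_le hM0 fun t x ht => hθ.le_mul_add (fun x => hM.2 ⟨x, rfl⟩) hM0.le ht x
  have : Nonempty Y := .map π ‹_›
  -- the inverse time change grows at most as fast as `s / m + 1`
  have lower' : meanDim ψ ≤ ENNReal.ofReal m⁻¹ * meanDim φ := by
    refine hθ'.meanDim_le (b := 1) (inv_pos.2 hm0) fun s y hs => ?_
    have h1 := hθ.mul_sub_le (fun x => hm.2 ⟨x, rfl⟩) hm0.le (hθ'.nonneg hs y) (π.symm y)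
    rw [hθ.apply_symm hψ hθ'] at h1
    rw [inv_mul_eq_div, ← sub_le_iff_le_add, le_div_iff₀ hm0]
    linarith
  have lower : ENNReal.ofReal m * meanDim ψ ≤ meanDim φ := by
    calc _ ≤ ENNReal.ofReal m * (ENNReal.ofReal m⁻¹ * meanDim φ) := by gcongr
      _ = meanDim φ := by
        rw [← mul_assoc, ← ENNReal.ofReal_mul hm0.le, mul_inv_cancel₀ hm0.ne',
          ENNReal.ofReal_one, one_mul]
  exact ⟨θ, hθ, fun θ'' h => hθ.unique hψ h, m, M, hm, hM, hm0, hmM, lower, upper,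
    ENNReal.exists_eq_ofReal_mul hm0 lower upper⟩
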